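/- Let $N\ge 2$, $\mathbb{Z}_N=\{0,\dots,N-1\}$, and let $(S_i)_{i\in\mathbb{Z}_N}$ be a representation of the Cuntz algebra $\mathcal{O}_N$ on a complex Hilbert space $\mathcal{H}$, i.e. bounded operators with $S_i^*S_j=\delta_{ij}I$ and $\sum_{i}S_iS_i^*=I$. For a finite word $I=i_1\dots i_n$ put $S_I=S_{i_1}\cdots S_{i_n}$. Let $\mathcal{K}=\mathbb{Z}_N^{\mathbb{N}}$ be the Cantor group (product topology, Borel $\sigma$-algebra $\mathcal{B}(\mathcal{K})$), $\mathcal{C}(I)=\{\omega\in\mathcal{K}:\omega_1=i_1,\dots,\omega_n=i_n\}$, $\sigma(\omega_1\omega_2\dots)=\omega_2\omega_3\dots$ and $\sigma_i(\omega_1\omega_2\dots)=i\omega_1\omega_2\dots$. Let $\widehat{\mathcal{K}}$ be the dual group, i.e. the group of sequences $\xi=(\xi_1\xi_2\dots)$ in $\mathbb{Z}_N$ with finitely many non-zero terms, with duality $\langle\omega,\xi\rangle=\prod_k e^{2\pi i\omega_k\xi_k/N}$, let $\widehat\sigma(\xi_1\xi_2\dots)=(0\xi_1\xi_2\dots)$,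 and for a word $I$ put $\langle I,\xi\rangle=\langle I00\dots,\xi\rangle$. Then the following hold. 1. There is a unique projection-valued measure $P$ on $\mathcal{B}(\mathcal{K})$ with $P(\mathcal{C}(I))=S_IS_I^*$ for every finite word $I$. 2. For $\xi=\xi_1\dots\xi_n00\dots\in\widehat{\mathcal{K}}$ the operator $U(\xi)=\sum_{I\in\mathbb{Z}_N^n}\langle I,\xi\rangle S_IS_I^*$ does not depend on the choice of $n$, and $U$ is a unitary representation of $\widehat{\mathcal{K}}$ on $\mathcal{H}$. 3. $P$ is the spectral decomposition of $U$, i.e. $U(\xi)=\int_{\mathcal{K}}\langle\omega,\xi\rangle\,P(d\omega)$ for all $\xi\in\widehat{\mathcal{K}}$. 4. For all $i\in\mathbb{Z}_N$ and $A\in\mathcal{B}(\mathcal{K})$: $S_iP(A)S_i^*=P(\sigma_i(A))$ and $\sum_{j\in\mathbb{Z}_N}S_jP(\sigma_j^{-1}(A))S_j^*=P(A)$. 5. The map $\alpha(T)=\sum_{i\in\mathbb{Z}_N}S_iTS_i^*$ is a (unital $*$-)endomorphism of $B(\mathcal{H})$, and $\alpha(P(A))=P(\sigma^{-1}(A))$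 for all $A\in\mathcal{B}(\mathcal{K})$. 6. $\alpha\left(\int_{\mathcal{K}}f\,dP\right)=\int_{\mathcal{K}}f\circ\sigma\,dP$ for every bounded measurable $f:\mathcal{K}\to\mathbb{C}$, and $\alpha(U(\xi))=U(\widehat\sigma(\xi))$ for all $\xi\in\widehat{\mathcal{K}}$. -/

import Mathlib

open MeasureTheory

noncomputable section

/-! ### Projection-valued measures -/

/-- A projection-valued measure on the measurable space `X`, acting on the Hilbert space `H`:
a map `P` from measurable sets to orthogonal projections with `P X = 1`,
`P (A ∩ B) = P A * P B`, countably additive in the strong operator topology.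
The value on non-measurable sets is set to `0`, so that `P` is determined by its values on
measurable sets. -/
structure ProjectionValuedMeasure (X : Type*) [MeasurableSpace X] (H : Type*)
    [NormedAddCommGroup H] [InnerProductSpace ℂ H] [CompleteSpace H] where
  /-- The underlying set function. -/
  toFun : Set X → H →L[ℂ] H
  isStarProjection' : ∀ A, MeasurableSet A → IsStarProjection (toFun A)
  univ' : toFun Set.univ = 1
  inter' : ∀ A B, MeasurableSet A → MeasurableSet B → toFun (A ∩ B) = toFun A * toFun B
  hasSum' : ∀ A : ℕ → Set X, (∀ n, MeasurableSet (A n)) → Pairwise (Function.onFun Disjoint A) →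
    ∀ ψ : H, HasSum (fun n => toFun (A n) ψ) (toFun (⋃ n, A n) ψ)
  not_measurable' : ∀ A, ¬ MeasurableSet A → toFun A = 0

namespace ProjectionValuedMeasure

variable {X : Type*} [MeasurableSpace X] {H : Type*}
  [NormedAddCommGroup H] [InnerProductSpace ℂ H] [CompleteSpace H]

instance : CoeFun (ProjectionValuedMeasure X H) (fun _ => Set X → H →L[ℂ] H) := ⟨toFun⟩

theorem inner_self (P : ProjectionValuedMeasure X H) {A : Set X} (hA : MeasurableSet A) (ψ : H) :
    inner ℂ ψ (P A ψ) = ((‖P A ψ‖ ^ 2 : ℝ) : ℂ) := by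
  have h := P.isStarProjection' A hA
  have h1 : P A (P A ψ) = P A ψ := DFunLike.congr_fun h.isIdempotentElem.eq ψ
  have h2 : ContinuousLinearMap.adjoint (P A) = P A := h.isSelfAdjoint.star_eq
  have h3 : inner ℂ (P A ψ) (P A ψ) = inner ℂ ψ (P A ψ) := by
    rw [← ContinuousLinearMap.adjoint_inner_right, h2, h1]
  rw [← h3, inner_self_eq_norm_sq_to_K]
  push_cast
  rfl

theorem empty (P : ProjectionValuedMeasure X H) : P ∅ = 0 := by
  ext ψ
  have h := P.hasSum' (fun _ => ∅) (fun _ => MeasurableSet.empty)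
    (fun _ _ _ => by simp [Function.onFun]) ψ
  have := h.summable.tendsto_atTop_zero
  simpa using tendsto_nhds_unique tendsto_const_nhds this

/-- The scalar measure `μ_ψ(A) = ‖P(A)ψ‖² = ⟪ψ, P(A)ψ⟫`. -/
def scalarMeasure (P : ProjectionValuedMeasure X H) (ψ : H) : Measure X :=
  Measure.ofMeasurable (fun A _ => ENNReal.ofReal (‖P A ψ‖ ^ 2))
    (by simp [P.empty])
    (by
      intro A hA hd
      have h := (P.hasSum' A hA hd ψ).mapL (innerSL ℂ ψ)
      simp only [innerSL_apply_apply, P.inner_self (hA _), P.inner_self (MeasurableSet.iUnion hA)]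
        at h
      have h' : HasSum (fun n => ‖P (A n) ψ‖ ^ 2) (‖P (⋃ n, A n) ψ‖ ^ 2) :=
        Complex.hasSum_ofReal.mp h
      rw [← h'.tsum_eq, ENNReal.ofReal_tsum_of_nonneg (fun _ => by positivity) h'.summable])

theorem scalarMeasure_apply (P : ProjectionValuedMeasure X H) (ψ : H) {A : Set X}
    (hA : MeasurableSet A) : P.scalarMeasure ψ A = ENNReal.ofReal (‖P A ψ‖ ^ 2) :=
  Measure.ofMeasurable_apply A hA

instance (P : ProjectionValuedMeasure X H) (ψ : H) : IsFiniteMeasure (P.scalarMeasure ψ) :=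
  ⟨by rw [P.scalarMeasure_apply ψ MeasurableSet.univ]; exact ENNReal.ofReal_lt_top⟩

theorem scalarMeasure_real_univ (P : ProjectionValuedMeasure X H) (ψ : H) :
    (P.scalarMeasure ψ).real Set.univ = ‖ψ‖ ^ 2 := by
  rw [Measure.real, P.scalarMeasure_apply ψ MeasurableSet.univ, P.univ',
    ENNReal.toReal_ofReal (by positivity)]
  simp

/-- `T` is the integral of `f` against `P`: `⟪ψ, T ψ⟫ = ∫ f dμ_ψ` for all `ψ`. By polarization
at most one bounded operator `T` has this property. -/
def HasIntegral (P : ProjectionValuedMeasure X H) (f : X → ℂ) (T : H →L[ℂ] H) : Prop :=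
  ∀ ψ : H, inner ℂ ψ (T ψ) = ∫ x, f x ∂(P.scalarMeasure ψ)

theorem HasIntegral.unique {P : ProjectionValuedMeasure X H} {f : X → ℂ} {T T' : H →L[ℂ] H}
    (h : P.HasIntegral f T) (h' : P.HasIntegral f T') : T = T' := by
  have : (T : H →ₗ[ℂ] H) = T' := by
    rw [← ext_inner_map]
    intro ψ
    have := (h ψ).trans (h' ψ).symm
    simpa using congrArg (starRingEnd ℂ) this
  exact ContinuousLinearMap.coe_injective this

/-- Bounded measurable complex functions. -/
def IsBoundedMeasurable (f : X → ℂ) : Prop :=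
  Measurable f ∧ ∃ C : ℝ, ∀ x, ‖f x‖ ≤ C

theorem IsBoundedMeasurable.integrable {f : X → ℂ} (hf : IsBoundedMeasurable f)
    (μ : Measure X) [IsFiniteMeasure μ] : Integrable f μ := by
  obtain ⟨hm, C, hC⟩ := hf
  exact Integrable.of_bound hm.aestronglyMeasurable C (Filter.Eventually.of_forall hC)

theorem isBoundedMeasurable_simpleFunc (s : SimpleFunc X ℂ) : IsBoundedMeasurable s :=
  ⟨s.measurable, s.exists_forall_norm_le⟩

theorem hasIntegral_simpleFunc (P : ProjectionValuedMeasure X H) (s : SimpleFunc X ℂ) :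
    ∃ T, P.HasIntegral s T := by
  induction s using SimpleFunc.induction with
  | const c hs =>
    rename_i A
    refine ⟨c • P A, fun ψ => ?_⟩
    have h1 : (fun x => (SimpleFunc.piecewise A hs (SimpleFunc.const X c)
        (SimpleFunc.const X 0)) x) = A.indicator (fun _ => c) := by
      ext x
      simp [SimpleFunc.coe_piecewise, Set.piecewise, Set.indicator]
    rw [h1, integral_indicator_const _ hs, Measure.real, P.scalarMeasure_apply ψ hs,
      ENNReal.toReal_ofReal (by positivity), _root_.smul_apply, inner_smul_right,
      P.inner_self hs, Complex.real_smul, mul_comm]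
  | add hd h1 h2 =>
    rename_i f g
    obtain ⟨T, hT⟩ := h1
    obtain ⟨T', hT'⟩ := h2
    refine ⟨T + T', fun ψ => ?_⟩
    have := integral_add ((isBoundedMeasurable_simpleFunc f).integrable (P.scalarMeasure ψ))
      ((isBoundedMeasurable_simpleFunc g).integrable (P.scalarMeasure ψ))
    simp only [SimpleFunc.coe_add, Pi.add_apply, _root_.add_apply, inner_add_right,
      hT ψ, hT' ψ, this]

theorem HasIntegral.opNorm_sub_le {P : ProjectionValuedMeasure X H} {f g : X → ℂ}
    {T T' : H →L[ℂ] H} (hT : P.HasIntegral f T) (hT' : P.HasIntegral g T')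
    (hf : IsBoundedMeasurable f) (hg : IsBoundedMeasurable g) {C : ℝ} (hC0 : 0 ≤ C)
    (hC : ∀ x, ‖f x - g x‖ ≤ C) : ‖T - T'‖ ≤ 4 * C := by
  have hq : ∀ ψ, ‖inner ℂ ((T - T') ψ) ψ‖ ≤ C * ‖ψ‖ ^ 2 := by
    intro ψ
    rw [norm_inner_symm, _root_.sub_apply, inner_sub_right, hT ψ, hT' ψ,
      ← integral_sub (hf.integrable _) (hg.integrable _), ← P.scalarMeasure_real_univ ψ]
    exact norm_integral_le_of_norm_le_const (Filter.Eventually.of_forall hC)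
  have hb : ∀ x y : H, ‖x‖ = 1 → ‖y‖ = 1 → ‖inner ℂ ((T - T') y) x‖ ≤ 4 * C := by
    intro x y hx hy
    have key : ∀ u : H, ‖u‖ ≤ 2 → ‖inner ℂ ((T - T') u) u‖ ≤ 4 * C := by
      intro u hu
      refine (hq u).trans ?_
      nlinarith [norm_nonneg u, mul_le_mul hu hu (norm_nonneg u) (by norm_num)]
    have hp := inner_map_polarization ((T - T' : H →L[ℂ] H) : H →ₗ[ℂ] H) x y
    simp only [ContinuousLinearMap.coe_coe] at hp
    have hI : ‖Complex.I • y‖ = 1 := by rw [norm_smul, Complex.norm_I, hy, one_mul]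
    have a1 := key (x + y) (by linarith [norm_add_le x y])
    have a2 := key (x - y) (by linarith [norm_sub_le x y])
    have a3 := key (x + Complex.I • y) (by linarith [norm_add_le x (Complex.I • y)])
    have a4 := key (x - Complex.I • y) (by linarith [norm_sub_le x (Complex.I • y)])
    rw [hp, norm_div]
    have h4 : ‖(4 : ℂ)‖ = 4 := by norm_num
    rw [h4, div_le_iff₀ (by norm_num)]
    refine (norm_sub_le _ _).trans ?_
    refine (add_le_add_left (norm_add_le _ _) _).trans ?_
    refine (add_le_add_left (add_le_add_left (norm_sub_le _ _) _) _).trans ?_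
    simp only [norm_mul, Complex.norm_I, one_mul]
    linarith
  refine ContinuousLinearMap.opNorm_le_bound _ (by linarith) fun y => ?_
  by_cases hy : y = 0
  · simp [hy]
  by_cases hz : (T - T') y = 0
  · rw [hz, norm_zero]; positivity
  have hy' : (‖y‖ : ℂ) ≠ 0 := by simpa using hy
  have hz' : (‖(T - T') y‖ : ℂ) ≠ 0 := by
    rw [Complex.ofReal_ne_zero]; exact norm_ne_zero_iff.mpr hz
  have hyr : 0 < ‖y‖ := norm_pos_iff.mpr hy
  have hzr : 0 < ‖(T - T') y‖ := norm_pos_iff.mpr hz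
  have h := hb ((‖(T - T') y‖ : ℂ)⁻¹ • (T - T') y) ((‖y‖ : ℂ)⁻¹ • y)
    (by rw [norm_smul, norm_inv, Complex.norm_real, norm_norm, inv_mul_cancel₀ hzr.ne'])
    (by rw [norm_smul, norm_inv, Complex.norm_real, norm_norm, inv_mul_cancel₀ hyr.ne'])
  rw [map_smul, inner_smul_left, inner_smul_right, inner_self_eq_norm_sq_to_K, norm_mul, norm_mul,
    RCLike.norm_conj, norm_inv, norm_inv, Complex.norm_real, Complex.norm_real, norm_norm,
    norm_norm, norm_pow] at h
  have h5 : ‖((‖(T - T') y‖ : ℝ) : ℂ)‖ = ‖(T - T') y‖ := by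
    rw [Complex.norm_real, norm_norm]
  change ‖y‖⁻¹ * (‖(T - T') y‖⁻¹ * ‖((‖(T - T') y‖ : ℝ) : ℂ)‖ ^ 2) ≤ 4 * C at h
  rw [h5, pow_two, inv_mul_cancel_left₀ hzr.ne', inv_mul_le_iff₀ hyr] at h
  linarith

theorem exists_simpleFunc_near {f : X → ℂ} (hf : IsBoundedMeasurable f) {ε : ℝ} (hε : 0 < ε) :
    ∃ s : SimpleFunc X ℂ, ∀ x, ‖f x - s x‖ ≤ ε := by
  obtain ⟨hm, C, hC⟩ := hf
  have hδ : 0 < ε / 2 := by positivity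
  set δ := ε / 2 with hδdef
  let q : ℝ → ℤ := fun r => ⌊r / δ⌋
  let e : ℤ × ℤ → ℂ := fun p => ⟨p.1 * δ, p.2 * δ⟩
  let g : X → ℤ × ℤ := fun x => (q (f x).re, q (f x).im)
  have hqm : Measurable q := Int.measurable_floor.comp (measurable_id.div_const δ)
  have hg : Measurable g :=
    (hqm.comp (Complex.measurable_re.comp hm)).prodMk (hqm.comp (Complex.measurable_im.comp hm))
  have he : Measurable e := measurable_of_countable e
  have hqr : ∀ r, |r| ≤ C → q r ∈ Set.Icc (q (-C)) (q C) := by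
    intro r hr
    have := abs_le.mp hr
    constructor
    · exact Int.floor_le_floor (by gcongr; exact this.1)
    · exact Int.floor_le_floor (by gcongr; exact this.2)
  have hfin : (Set.range (e ∘ g)).Finite := by
    rw [Set.range_comp]
    refine Set.Finite.image _ (((Set.finite_Icc (q (-C)) (q C)).prod
      (Set.finite_Icc (q (-C)) (q C))).subset ?_)
    rintro _ ⟨x, rfl⟩
    exact ⟨hqr _ ((Complex.abs_re_le_norm _).trans (hC x)),
      hqr _ ((Complex.abs_im_le_norm _).trans (hC x))⟩
  have hnear : ∀ r : ℝ, |r - q r * δ| ≤ δ := by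
    intro r
    have h1 : (q r : ℝ) * δ ≤ r := (le_div_iff₀ hδ).mp (Int.floor_le _)
    have h2 : r < (q r + 1 : ℝ) * δ := (div_lt_iff₀ hδ).mp (Int.lt_floor_add_one _)
    rw [abs_le]
    constructor <;> nlinarith
  refine ⟨⟨e ∘ g, fun y => (he.comp hg) (measurableSet_singleton y), hfin⟩, fun x => ?_⟩
  refine (Complex.norm_le_abs_re_add_abs_im _).trans ?_
  have h1 := hnear (f x).re
  have h2 := hnear (f x).im
  change |(f x).re - q (f x).re * δ| + |(f x).im - q (f x).im * δ| ≤ ε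
  linarith

theorem exists_hasIntegral (P : ProjectionValuedMeasure X H) {f : X → ℂ}
    (hf : IsBoundedMeasurable f) : ∃ T, P.HasIntegral f T := by
  have hpos : ∀ n : ℕ, (0 : ℝ) < 1 / ((n : ℝ) + 1) := fun n => by positivity
  choose s hs using fun n : ℕ => exists_simpleFunc_near hf (hpos n)
  choose T hT using fun n => P.hasIntegral_simpleFunc (s n)
  have hlim : Filter.Tendsto (fun n : ℕ => 1 / ((n : ℝ) + 1)) Filter.atTop (nhds 0) :=
    tendsto_one_div_add_atTop_nhds_zero_nat
  have hc : CauchySeq T := by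
    refine cauchySeq_of_le_tendsto_0 (fun n : ℕ => 8 * (1 / ((n : ℝ) + 1))) ?_
      (by simpa using hlim.const_mul 8)
    intro n m k hn hm
    rw [dist_eq_norm]
    have hmono : ∀ j, k ≤ j → 1 / ((j : ℝ) + 1) ≤ 1 / ((k : ℝ) + 1) := by
      intro j hj
      gcongr
    refine ((hT n).opNorm_sub_le (hT m) (isBoundedMeasurable_simpleFunc _)
      (isBoundedMeasurable_simpleFunc _) (C := 2 * (1 / ((k : ℝ) + 1))) (by positivity) ?_).trans
      (by linarith)
    intro x
    have h1 := (hs n x).trans (hmono n hn)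
    have h2 := (hs m x).trans (hmono m hm)
    have h3 : s n x - s m x = (f x - s m x) - (f x - s n x) := by ring
    rw [h3]
    exact (norm_sub_le _ _).trans (by linarith)
  obtain ⟨T₀, hT₀⟩ := cauchySeq_tendsto_of_complete hc
  refine ⟨T₀, fun ψ => ?_⟩
  have l1 : Filter.Tendsto (fun n => inner ℂ ψ (T n ψ)) Filter.atTop
      (nhds (inner ℂ ψ (T₀ ψ))) :=
    tendsto_const_nhds.inner (((ContinuousLinearMap.apply ℂ H ψ).continuous.tendsto T₀).comp hT₀)
  have l2 : Filter.Tendsto (fun n => ∫ x, s n x ∂(P.scalarMeasure ψ)) Filter.atTop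
      (nhds (∫ x, f x ∂(P.scalarMeasure ψ))) := by
    rw [tendsto_iff_norm_sub_tendsto_zero]
    refine squeeze_zero (fun _ => norm_nonneg _) (fun n => ?_)
      (by simpa using hlim.mul_const (‖ψ‖ ^ 2))
    rw [← integral_sub ((isBoundedMeasurable_simpleFunc _).integrable _) (hf.integrable _),
      ← P.scalarMeasure_real_univ ψ]
    refine norm_integral_le_of_norm_le_const (Filter.Eventually.of_forall fun x => ?_)
    rw [norm_sub_rev]
    simpa using hs n x
  have l3 : (fun n => inner ℂ ψ (T n ψ)) = fun n => ∫ x, s n x ∂(P.scalarMeasure ψ) :=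
    funext fun n => hT n ψ
  rw [l3] at l1
  exact tendsto_nhds_unique l1 l2

open Classical in
/-- The integral `∫ f dP` of a bounded measurable function: the unique bounded operator `T` with
`⟪ψ, T ψ⟫ = ∫ f dμ_ψ` for all `ψ` (and `0` for any other function). -/
def integral (P : ProjectionValuedMeasure X H) (f : X → ℂ) : H →L[ℂ] H :=
  if h : IsBoundedMeasurable f then (P.exists_hasIntegral h).choose else 0

theorem hasIntegral_integral (P : ProjectionValuedMeasure X H) {f : X → ℂ}
    (hf : IsBoundedMeasurable f) : P.HasIntegral f (P.integral f) := by
  rw [integral, dif_pos hf]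
  exact (P.exists_hasIntegral hf).choose_spec

end ProjectionValuedMeasure

/-! ### Cuntz relations, words and the Cantor group -/

namespace Cuntz

/-- A representation of the Cuntz algebra `𝒪_N` on `H`, given by the images `S i` of the
generators: bounded operators satisfying the Cuntz relations. -/
structure IsRepresentation {N : ℕ} [NeZero N] {H : Type*} [NormedAddCommGroup H]
    [InnerProductSpace ℂ H] [CompleteSpace H] (S : ZMod N → H →L[ℂ] H) : Prop where
  star_mul : ∀ i j, star (S i) * S j = if i = j then 1 else 0
  sum_mul_star : ∑ i, S i * star (S i) = 1

/-- The operator `S_I = S_{i_1} ⋯ S_{i_n}` for a word `I = i_1 … i_n` of length `n`. -/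
def wordOp {N : ℕ} {H : Type*} [NormedAddCommGroup H] [InnerProductSpace ℂ H]
    (S : ZMod N → H →L[ℂ] H) {n : ℕ} (I : Fin n → ZMod N) : H →L[ℂ] H :=
  (List.ofFn fun k => S (I k)).prod

/-- The Cantor group on `N` letters, with the product topology, the Borel σ-algebra
(which is the product σ-algebra) and coordinatewise addition. Letters are indexed from `0`. -/
abbrev CantorGroup (N : ℕ) : Type := ℕ → ZMod N

theorem borelSpace_cantorGroup (N : ℕ) [NeZero N] : BorelSpace (CantorGroup N) := inferInstance

/-- The dual group of the Cantor group: sequences with finitely many non-zero terms. -/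
abbrev DualGroup (N : ℕ) : Type := ℕ →₀ ZMod N

/-- The cylinder set of a finite word. -/
def cylinder {N n : ℕ} (I : Fin n → ZMod N) : Set (CantorGroup N) :=
  {ω | ∀ k : Fin n, ω k = I k}

/-- The shift `σ(ω₁ω₂…) = ω₂ω₃…`. -/
def shift {N : ℕ} (ω : CantorGroup N) : CantorGroup N := fun k => ω (k + 1)

/-- The inverse branches `σ_i(ω₁ω₂…) = iω₁ω₂…` of the shift. -/
def prepend {N : ℕ} (i : ZMod N) (ω : CantorGroup N) : CantorGroup N
  | 0 => i
  | k + 1 => ω k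

/-- The Fourier duality `⟨ω, ξ⟩ = ∏ₖ exp (2πi ωₖ ξₖ / N)`; the factors with `ξₖ = 0` are `1`. -/
def pairing {N : ℕ} (ω : CantorGroup N) (ξ : DualGroup N) : ℂ :=
  ∏ k ∈ ξ.support,
    Complex.exp (2 * Real.pi * Complex.I * (((ω k).val : ℂ) * ((ξ k).val : ℂ)) / (N : ℂ))

/-- The infinite word `I00…`. -/
def extendZero {N n : ℕ} (I : Fin n → ZMod N) : CantorGroup N :=
  fun k => if h : k < n then I ⟨k, h⟩ else 0

/-- The dual of the shift, `σ̂(ξ₁ξ₂…) = 0ξ₁ξ₂…`. -/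
def dualShift {N : ℕ} (ξ : DualGroup N) : DualGroup N :=
  Finsupp.embDomain ⟨Nat.succ, Nat.succ_injective⟩ ξ

/-- The defining property of the dual of the shift. -/
theorem pairing_dualShift {N : ℕ} (ω : CantorGroup N) (ξ : DualGroup N) :
    pairing ω (dualShift ξ) = pairing (shift ω) ξ := by
  unfold pairing dualShift
  rw [Finsupp.support_embDomain, Finset.prod_map]
  refine Finset.prod_congr rfl fun k _ => ?_
  rw [Finsupp.embDomain_apply_self]
  rfl

end Cuntz

end

/-!
For a vector `ψ` the masses `‖S_I* ψ‖²` of the cylinders `𝒞(I)` are consistent, because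
`∑ᵢ ‖Sᵢ* ψ‖² = ‖ψ‖²`. Place the mass `‖S_I* ψ‖²` at the point `I00…` for all words `I` of
length `n`. Cylinders are clopen, so a weak limit point `μ_ψ` of these discrete measures as
`n → ∞` has the prescribed mass on every cylinder. The measurable sets `A` for which some orthogonal
projection has quadratic form `ψ ↦ μ_ψ(A)` contain the cylinders and are closed under complements
and countable disjoint unions, so by the π-λ theorem they are all the Borel sets; these projections
form `P`.

The Cuntz relations make the scalar measures self-similar: `μ_ψ` is the sum of the images under
`σᵢ` of the measures of `Sᵢ* ψ`. Hence `∑ᵢ Sᵢ (∫ f ∘ σᵢ dP) Sᵢ* = ∫ f dP`, which contains all the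
covariance relations. A character of the Cantor group is a finite combination of indicators of
cylinders, which gives the formula for `U`.
-/

open Filter Topology

section HilbertSpace

variable {H : Type*} [NormedAddCommGroup H] [InnerProductSpace ℂ H]

theorem eq_of_inner_apply_self {T T' : H →L[ℂ] H}
    (h : ∀ ψ, inner ℂ ψ (T ψ) = inner ℂ ψ (T' ψ)) : T = T' := by
  refine ContinuousLinearMap.coe_injective ((ext_inner_map _ _).1 fun ψ => ?_)
  simpa using congrArg (starRingEnd ℂ) (h ψ)

variable [CompleteSpace H]

theorem inner_mul_star_apply (W T : H →L[ℂ] H) (ψ : H) :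
    inner ℂ ψ ((W * T * star W) ψ) = inner ℂ (star W ψ) (T (star W ψ)) :=
  (ContinuousLinearMap.adjoint_inner_left W _ ψ).symm

theorem inner_mul_star_self_apply (W : H →L[ℂ] H) (ψ : H) :
    inner ℂ ψ ((W * star W) ψ) = ((‖star W ψ‖ ^ 2 : ℝ) : ℂ) := by
  rw [Complex.ofReal_pow]
  exact (ContinuousLinearMap.adjoint_inner_left W _ ψ).symm.trans (inner_self_eq_norm_sq_to_K _)

theorem isStarProjection_mul_star_self {R : Type*} [Monoid R] [StarMul R] {w : R}
    (hw : star w * w = 1) : IsStarProjection (w * star w) where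
  isIdempotentElem := by rw [IsIdempotentElem, mul_assoc, ← mul_assoc (star w), hw, one_mul]
  isSelfAdjoint := .mul_star_self w

theorem apply_eq_zero_of_inner_apply_self_eq_zero {T : H →L[ℂ] H} (hT : IsStarProjection T) {ψ : H}
    (h : inner ℂ ψ (T ψ) = 0) : T ψ = 0 := by
  have hnorm := inner_mul_star_self_apply T ψ
  rw [hT.isSelfAdjoint.star_eq, hT.isIdempotentElem.eq, h] at hnorm
  exact norm_eq_zero.1 (pow_eq_zero_iff two_ne_zero |>.1 (by exact_mod_cast hnorm.symm))

theorem exists_isStarProjection_tendsto {ι : Type*} [Preorder ι] {T : ι → H →L[ℂ] H}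
    (hT : ∀ i, IsStarProjection (T i)) (hmono : ∀ i j, i ≤ j → T j * T i = T i) :
    ∃ T₀ : H →L[ℂ] H, IsStarProjection T₀ ∧ ∀ ψ, Tendsto (fun i => T i ψ) atTop (𝓝 (T₀ ψ)) := by
  choose _ hrange using fun i => isStarProjection_iff_eq_starProjection_range.mp (hT i)
  have hU : Monotone fun i => (T i).range := by
    rintro i j hij _ ⟨ψ, rfl⟩
    exact ⟨T i ψ, DFunLike.congr_fun (hmono i j hij) ψ⟩
  refine ⟨(⨆ i, (T i).range).topologicalClosure.starProjection,
    isStarProjection_starProjection, fun ψ => ?_⟩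
  refine (Submodule.starProjection_tendsto_closure_iSup (fun i => (T i).range) hU ψ).congr
    fun i => ?_
  conv_rhs => rw [hrange i]

theorem exists_isStarProjection_hasSum {ι : Type*} {T : ι → H →L[ℂ] H}
    (hT : ∀ i, IsStarProjection (T i)) (hortho : Pairwise fun i j => T i * T j = 0) :
    ∃ T₀ : H →L[ℂ] H, IsStarProjection T₀ ∧ ∀ ψ, HasSum (fun i => T i ψ) (T₀ ψ) := by
  have hidem : OrthogonalIdempotents T := ⟨fun i => (hT i).isIdempotentElem, hortho⟩
  have hproj (s : Finset ι) : IsStarProjection (∑ i ∈ s, T i) :=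
    ⟨hidem.isIdempotentElem_sum, isSelfAdjoint_sum s fun i _ => (hT i).isSelfAdjoint⟩
  have hmono (s t : Finset ι) (hst : s ≤ t) : (∑ i ∈ t, T i) * ∑ i ∈ s, T i = ∑ i ∈ s, T i := by
    have h : (∑ i ∈ s, T i) * ∑ i ∈ t, T i = ∑ i ∈ s, T i := by
      rw [Finset.sum_mul]
      exact Finset.sum_congr rfl fun i hi => hidem.mul_sum_of_mem (hst hi)
    simpa only [star_mul, (hproj _).isSelfAdjoint.star_eq] using congrArg star h
  obtain ⟨T₀, hT₀, hlim⟩ := exists_isStarProjection_tendsto hproj hmono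
  refine ⟨T₀, hT₀, fun ψ => ?_⟩
  simpa only [HasSum, SummationFilter.unconditional_filter, sum_apply] using hlim ψ

end HilbertSpace

theorem hasSum_measureReal_iUnion {X : Type*} [MeasurableSpace X] {μ : Measure X}
    [IsFiniteMeasure μ] {A : ℕ → Set X} (hd : Pairwise (Function.onFun Disjoint A))
    (hA : ∀ n, MeasurableSet (A n)) :
    HasSum (fun n => μ.real (A n)) (μ.real (⋃ n, A n)) := by
  rw [Measure.real, measure_iUnion hd hA, ENNReal.tsum_toReal_eq fun _ => measure_ne_top _ _]
  exact ENNReal.hasSum_toReal (measure_iUnion hd hA ▸ measure_ne_top _ _)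

namespace ProjectionValuedMeasure

variable {X : Type*} [mX : MeasurableSpace X] {H : Type*}
  [NormedAddCommGroup H] [InnerProductSpace ℂ H] [CompleteSpace H]

/-- `T` is a spectral projection of the family of measures `μ` on the set `A`: an orthogonal
projection with `⟪ψ, T ψ⟫ = μ_ψ(A)` for all `ψ`. A projection-valued measure is recovered from its
scalar measures through these projections. -/
structure IsSpectralProjection (μ : H → Measure X) (A : Set X) (T : H →L[ℂ] H) : Prop where
  isStarProjection : IsStarProjection T
  inner_apply (ψ : H) : inner ℂ ψ (T ψ) = ((μ ψ).real A : ℂ)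

namespace IsSpectralProjection

variable {μ : H → Measure X} {A B : Set X} {T T' : H →L[ℂ] H}

theorem unique (hT : IsSpectralProjection μ A T) (hT' : IsSpectralProjection μ A T') : T = T' :=
  eq_of_inner_apply_self fun ψ => (hT.inner_apply ψ).trans (hT'.inner_apply ψ).symm

theorem empty : IsSpectralProjection μ ∅ 0 where
  isStarProjection := .zero _
  inner_apply ψ := by simp

theorem of_star_mul_self {W : H →L[ℂ] H} (hW : star W * W = 1)
    (h : ∀ ψ, (μ ψ).real A = ‖star W ψ‖ ^ 2) : IsSpectralProjection μ A (W * star W) where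
  isStarProjection := isStarProjection_mul_star_self hW
  inner_apply ψ := by rw [inner_mul_star_self_apply, h]

variable [∀ ψ, IsFiniteMeasure (μ ψ)]

theorem compl (huniv : IsSpectralProjection μ Set.univ 1) (hT : IsSpectralProjection μ A T)
    (hA : MeasurableSet A) : IsSpectralProjection μ Aᶜ (1 - T) where
  isStarProjection := hT.isStarProjection.one_sub
  inner_apply ψ := by
    rw [sub_apply, inner_sub_right, huniv.inner_apply, hT.inner_apply, measureReal_compl hA,
      Complex.ofReal_sub]

theorem mul_eq_zero (huniv : IsSpectralProjection μ Set.univ 1) (hT : IsSpectralProjection μ A T)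
    (hT' : IsSpectralProjection μ B T') (hA : MeasurableSet A) (hAB : Disjoint A B) :
    T' * T = 0 := by
  -- `⟪T ψ, T' T ψ⟫ = μ_{T ψ}(B) ≤ μ_{T ψ}(Aᶜ) = ⟪T ψ, (1 - T) T ψ⟫ = 0`
  refine ContinuousLinearMap.ext fun ψ => ?_
  have hcompl : (μ (T ψ)).real Aᶜ = 0 := by
    have hTT : (1 - T) (T ψ) = 0 := by
      rw [sub_apply, one_apply_eq_self, sub_eq_zero]
      exact (DFunLike.congr_fun hT.isStarProjection.isIdempotentElem.eq ψ).symm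
    have h := (compl huniv hT hA).inner_apply (T ψ)
    rw [hTT, inner_zero_right] at h
    exact_mod_cast h.symm
  have hB : inner ℂ (T ψ) (T' (T ψ)) = 0 := by
    rw [hT'.inner_apply, measureReal_mono_null hAB.subset_compl_left hcompl, Complex.ofReal_zero]
  exact apply_eq_zero_of_inner_apply_self_eq_zero hT'.isStarProjection hB

theorem union (huniv : IsSpectralProjection μ Set.univ 1) (hT : IsSpectralProjection μ A T)
    (hT' : IsSpectralProjection μ B T') (hB : MeasurableSet B)
    (hAB : Disjoint A B) : IsSpectralProjection μ (A ∪ B) (T + T') where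
  isStarProjection :=
    hT.isStarProjection.add hT'.isStarProjection (mul_eq_zero huniv hT' hT hB hAB.symm)
  inner_apply ψ := by
    rw [add_apply, inner_add_right, hT.inner_apply, hT'.inner_apply,
      measureReal_union hAB hB, Complex.ofReal_add]

theorem exists_iUnion (huniv : IsSpectralProjection μ Set.univ 1) {A : ℕ → Set X}
    {T : ℕ → H →L[ℂ] H} (hT : ∀ n, IsSpectralProjection μ (A n) (T n))
    (hA : ∀ n, MeasurableSet (A n)) (hd : Pairwise (Function.onFun Disjoint A)) :
    ∃ T₀, IsSpectralProjection μ (⋃ n, A n) T₀ ∧ ∀ ψ, HasSum (fun n => T n ψ) (T₀ ψ) := by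
  obtain ⟨T₀, hT₀, hsum⟩ := exists_isStarProjection_hasSum (fun n => (hT n).isStarProjection)
    fun m n hmn => mul_eq_zero huniv (hT n) (hT m) (hA n) (hd hmn.symm)
  refine ⟨T₀, ⟨hT₀, fun ψ => ?_⟩, hsum⟩
  have hinner : HasSum (fun n => ((μ ψ).real (A n) : ℂ)) (inner ℂ ψ (T₀ ψ)) := by
    simpa only [innerSL_apply_apply, (hT _).inner_apply] using (hsum ψ).mapL (innerSL ℂ ψ)
  exact hinner.unique (Complex.hasSum_ofReal.2 (hasSum_measureReal_iUnion hd hA))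

theorem inter (huniv : IsSpectralProjection μ Set.univ 1) {R Q : H →L[ℂ] H}
    (hT : IsSpectralProjection μ A T) (hT' : IsSpectralProjection μ B T')
    (hR : IsSpectralProjection μ (A ∩ B) R) (hQ : IsSpectralProjection μ (A \ B) Q)
    (hA : MeasurableSet A) (hB : MeasurableSet B) : R = T * T' := by
  have hsplit : T = R + Q := by
    refine hT.unique ?_
    rw [← Set.inter_union_sdiff A B]
    exact union huniv hR hQ (hA.diff hB) Set.disjoint_sdiff_inter.symm
  have hR' : R * (1 - T') = 0 := mul_eq_zero huniv (compl huniv hT' hB) hR hB.compl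
    (disjoint_compl_left.mono_right Set.inter_subset_right)
  have hQ' : Q * T' = 0 := mul_eq_zero huniv hT' hQ hB Set.disjoint_sdiff_right
  rw [mul_sub, mul_one, sub_eq_zero] at hR'
  rw [hsplit, add_mul, ← hR', hQ', add_zero]

theorem exists_of_generateFrom (huniv : IsSpectralProjection μ Set.univ 1) {C : Set (Set X)}
    (hgen : mX = MeasurableSpace.generateFrom C) (hpi : IsPiSystem C)
    (hC : ∀ A ∈ C, ∃ T, IsSpectralProjection μ A T) {A : Set X} (hA : MeasurableSet A) :
    ∃ T, IsSpectralProjection μ A T := by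
  induction A, hA using MeasurableSpace.induction_on_inter hgen hpi with
  | empty => exact ⟨0, empty⟩
  | basic A hA => exact hC A hA
  | compl A hA ih => exact ih.imp' _ fun _ hT => compl huniv hT hA
  | iUnion A hd hA ih =>
    choose T hT using ih
    exact (exists_iUnion huniv hT hA hd).imp fun _ h => h.1

open Classical in
theorem exists_projectionValuedMeasure (huniv : IsSpectralProjection μ Set.univ 1)
    (h : ∀ A, MeasurableSet A → ∃ T, IsSpectralProjection μ A T) :
    ∃ P : ProjectionValuedMeasure X H, ∀ A, MeasurableSet A → IsSpectralProjection μ A (P A) := by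
  choose T hT using h
  let F (A : Set X) : H →L[ℂ] H := if hA : MeasurableSet A then T A hA else 0
  have hF (A : Set X) (hA : MeasurableSet A) : IsSpectralProjection μ A (F A) := by
    simpa only [F, dif_pos hA] using hT A hA
  exact ⟨{
    toFun := F
    isStarProjection' := fun A hA => (hF A hA).isStarProjection
    univ' := (hF _ .univ).unique huniv
    inter' := fun A B hA hB =>
      inter huniv (hF A hA) (hF B hB) (hF _ (hA.inter hB)) (hF _ (hA.diff hB)) hA hB
    hasSum' := fun A hA hd ψ => by
      obtain ⟨T₀, hT₀, hsum⟩ := exists_iUnion huniv (fun n => hF _ (hA n)) hA hd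
      rw [(hF _ (.iUnion hA)).unique hT₀]
      exact hsum ψ
    not_measurable' := fun A hA => dif_neg hA }, hF⟩

end IsSpectralProjection

theorem isSpectralProjection (P : ProjectionValuedMeasure X H) {A : Set X}
    (hA : MeasurableSet A) : IsSpectralProjection P.scalarMeasure A (P A) where
  isStarProjection := P.isStarProjection' A hA
  inner_apply ψ := by
    rw [P.inner_self hA, Measure.real, P.scalarMeasure_apply ψ hA,
      ENNReal.toReal_ofReal (by positivity)]

theorem ext_of_scalarMeasure {P Q : ProjectionValuedMeasure X H}
    (h : P.scalarMeasure = Q.scalarMeasure) : P = Q := by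
  have hfun : P.toFun = Q.toFun := by
    funext A
    by_cases hA : MeasurableSet A
    · exact (P.isSpectralProjection hA).unique (h ▸ Q.isSpectralProjection hA)
    · rw [P.not_measurable' A hA, Q.not_measurable' A hA]
  cases P
  cases Q
  simpa using hfun

theorem HasIntegral.integral_eq {P : ProjectionValuedMeasure X H} {f : X → ℂ} {T : H →L[ℂ] H}
    (h : P.HasIntegral f T) (hf : IsBoundedMeasurable f) : P.integral f = T :=
  (P.hasIntegral_integral hf).unique h

theorem hasIntegral_indicator_const (P : ProjectionValuedMeasure X H) {A : Set X}
    (hA : MeasurableSet A) (c : ℂ) : P.HasIntegral (A.indicator fun _ => c) (c • P A) := fun ψ => by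
  rw [smul_apply, inner_smul_right, (P.isSpectralProjection hA).inner_apply,
    integral_indicator_const c hA, Complex.real_smul, mul_comm]

theorem IsBoundedMeasurable.indicator_const {A : Set X} (hA : MeasurableSet A) (c : ℂ) :
    IsBoundedMeasurable (A.indicator fun _ => c) :=
  ⟨measurable_const.indicator hA, ‖c‖, fun _ => norm_indicator_le_norm_self _ _⟩

theorem HasIntegral.sum {P : ProjectionValuedMeasure X H} {ι : Type*} {s : Finset ι}
    {f : ι → X → ℂ} {T : ι → H →L[ℂ] H} (h : ∀ i ∈ s, P.HasIntegral (f i) (T i))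
    (hf : ∀ i ∈ s, IsBoundedMeasurable (f i)) :
    P.HasIntegral (fun x => ∑ i ∈ s, f i x) (∑ i ∈ s, T i) := fun ψ => by
  rw [sum_apply, inner_sum, integral_finsetSum s fun i hi => (hf i hi).integrable _]
  exact Finset.sum_congr rfl fun i hi => h i hi ψ

theorem HasIntegral.star {P : ProjectionValuedMeasure X H} {f : X → ℂ} {T : H →L[ℂ] H}
    (h : P.HasIntegral f T) : P.HasIntegral (fun x => star (f x)) (star T) := fun ψ => by
  have hconj := integral_conj (𝕜 := ℂ) (f := f) (μ := P.scalarMeasure ψ)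
  rw [← h ψ, inner_conj_symm] at hconj
  exact (ContinuousLinearMap.adjoint_inner_right T ψ ψ).trans hconj.symm

end ProjectionValuedMeasure

theorem exists_isFiniteMeasure_real_eq_of_tendsto {X : Type*} [TopologicalSpace X] [T2Space X]
    [CompactSpace X] [MeasurableSpace X] [BorelSpace X] {ι : Type*} {l : Filter ι} [l.NeBot]
    (ν : ι → Measure X) [∀ i, IsFiniteMeasure (ν i)] {M : ℝ} (hM : ∀ i, (ν i).real Set.univ ≤ M) :
    ∃ μ : Measure X, IsFiniteMeasure μ ∧ ∀ A, IsClopen A → ∀ c,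
      Tendsto (fun i => (ν i).real A) l (𝓝 c) → μ.real A = c := by
  let ν' (i : ι) : FiniteMeasure X := ⟨ν i, inferInstance⟩
  have hmass : ∀ i, (ν' i).mass ≤ M.toNNReal := fun i =>
    NNReal.le_toNNReal_of_coe_le (hM i)
  obtain ⟨μ, -, hμ⟩ := (isCompact_setOfPred_finiteMeasure_le_of_compactSpace X
    M.toNNReal).exists_mapClusterPt (f := l) (u := ν')
      (tendsto_principal.2 (Eventually.of_forall hmass))
  refine ⟨μ, inferInstance, fun A hA c hc => ?_⟩
  let g := BoundedContinuousFunction.indicator A hA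
  have hg (ρ : FiniteMeasure X) : ∫ x, g x ∂(ρ : Measure X) = (ρ : Measure X).real A :=
    integral_indicator_one hA.isOpen.measurableSet
  have hcluster :=
    hμ.tendsto_comp (FiniteMeasure.tendsto_iff_forall_integral_tendsto.1 tendsto_id g)
  simp only [Function.comp_def, id, hg] at hcluster
  exact eq_of_nhds_neBot (hcluster.neBot.mono (inf_le_inf_left _ hc))

namespace Cuntz

section CantorGroup

variable {N : ℕ}

theorem cylinder_zero (I : Fin 0 → ZMod N) : cylinder I = Set.univ :=
  Set.eq_univ_of_forall fun _ k => k.elim0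

theorem isClopen_cylinder {n : ℕ} (I : Fin n → ZMod N) : IsClopen (cylinder I) := by
  rw [cylinder, Set.ofPred_forall]
  exact isClopen_iInter_of_finite fun k =>
    (isClopen_discrete {I k}).preimage (continuous_apply (k : ℕ))

theorem measurableSet_cylinder {n : ℕ} (I : Fin n → ZMod N) : MeasurableSet (cylinder I) := by
  rw [cylinder, Set.ofPred_forall]
  exact MeasurableSet.iInter fun k =>
    (measurableSet_singleton (I k)).preimage (measurable_pi_apply (k : ℕ))

theorem disjoint_cylinder {n : ℕ} {I J : Fin n → ZMod N} (h : I ≠ J) :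
    Disjoint (cylinder I) (cylinder J) :=
  Set.disjoint_left.mpr fun _ hI hJ => h (funext fun k => (hI k).symm.trans (hJ k))

theorem mem_cylinder_restrict (ω : CantorGroup N) (n : ℕ) :
    ω ∈ cylinder fun k : Fin n => ω k := fun _ => rfl

theorem cylinder_subset_of_le {m n : ℕ} (hmn : m ≤ n) {I : Fin m → ZMod N} {J : Fin n → ZMod N}
    (h : (cylinder I ∩ cylinder J).Nonempty) : cylinder J ⊆ cylinder I := by
  intro ω hω k
  obtain ⟨ω', hI, hJ⟩ := h
  exact (hω ⟨k, k.2.trans_le hmn⟩).trans ((hJ ⟨k, k.2.trans_le hmn⟩).symm.trans (hI k))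

theorem isPiSystem_cylinder :
    IsPiSystem {A : Set (CantorGroup N) | ∃ (n : ℕ) (I : Fin n → ZMod N), A = cylinder I} := by
  rintro _ ⟨m, I, rfl⟩ _ ⟨n, J, rfl⟩ h
  rcases le_total m n with hmn | hnm
  · exact ⟨n, J, Set.inter_eq_right.2 (cylinder_subset_of_le hmn h)⟩
  · exact ⟨m, I, Set.inter_eq_left.2 (cylinder_subset_of_le hnm (Set.inter_comm _ _ ▸ h))⟩

theorem preimage_eval_eq_biUnion_cylinder (k : ℕ) (a : ZMod N) :
    (fun ω : CantorGroup N => ω k) ⁻¹' {a} =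
      ⋃ I ∈ {I : Fin (k + 1) → ZMod N | I (Fin.last k) = a}, cylinder I := by
  ext ω
  simp only [Set.mem_preimage, Set.mem_singleton_iff, Set.mem_ofPred_eq, Set.mem_iUnion,
    exists_prop]
  exact ⟨fun h => ⟨_, h, mem_cylinder_restrict ω (k + 1)⟩,
    fun ⟨I, hI, hω⟩ => (hω (Fin.last k)).trans hI⟩

theorem measurableSpace_eq_generateFrom_cylinder [NeZero N] :
    (inferInstance : MeasurableSpace (CantorGroup N)) = MeasurableSpace.generateFrom
      {A : Set (CantorGroup N) | ∃ (n : ℕ) (I : Fin n → ZMod N), A = cylinder I} := by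
  apply le_antisymm
  · refine iSup_le fun k => measurable_iff_comap_le.1 ?_
    refine @measurable_to_countable' _ _ _ _ (MeasurableSpace.generateFrom _) _ fun a => ?_
    rw [preimage_eval_eq_biUnion_cylinder]
    exact MeasurableSet.biUnion (Set.to_countable _) fun I _ =>
      MeasurableSpace.measurableSet_generateFrom ⟨_, I, rfl⟩
  · refine MeasurableSpace.generateFrom_le ?_
    rintro _ ⟨n, I, rfl⟩
    exact measurableSet_cylinder I

theorem ext_of_real_cylinder [NeZero N] {μ ν : Measure (CantorGroup N)} [IsFiniteMeasure μ]
    [IsFiniteMeasure ν]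
    (h : ∀ (n : ℕ) (I : Fin n → ZMod N), μ.real (cylinder I) = ν.real (cylinder I)) : μ = ν := by
  have hcyl (n : ℕ) (I : Fin n → ZMod N) : μ (cylinder I) = ν (cylinder I) :=
    (measureReal_eq_measureReal_iff).1 (h n I)
  refine ext_of_generate_finite _ measurableSpace_eq_generateFrom_cylinder isPiSystem_cylinder
    ?_ ?_
  · rintro _ ⟨n, I, rfl⟩
    exact hcyl n I
  · simpa only [cylinder_zero] using hcyl 0 Fin.elim0

theorem measurable_shift : Measurable (shift : CantorGroup N → CantorGroup N) :=
  measurable_pi_lambda _ fun k => measurable_pi_apply (k + 1)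

theorem measurable_prepend (i : ZMod N) : Measurable (prepend i) :=
  measurable_pi_lambda _ fun k => by
    cases k with
    | zero => exact measurable_const
    | succ k => exact measurable_pi_apply k

theorem prepend_shift (ω : CantorGroup N) : prepend (ω 0) (shift ω) = ω := by
  funext k
  cases k <;> rfl

theorem prepend_image (i : ZMod N) (A : Set (CantorGroup N)) :
    prepend i '' A = (fun ω => ω 0) ⁻¹' {i} ∩ shift ⁻¹' A := by
  ext ω
  constructor
  · rintro ⟨ω, hω, rfl⟩
    exact ⟨rfl, hω⟩
  · rintro ⟨rfl, hω⟩
    exact ⟨shift ω, hω, prepend_shift ω⟩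

theorem measurableSet_prepend_image (i : ZMod N) {A : Set (CantorGroup N)}
    (hA : MeasurableSet A) : MeasurableSet (prepend i '' A) := by
  rw [prepend_image]
  exact (measurable_pi_apply 0 (measurableSet_singleton i)).inter (measurable_shift hA)

theorem prepend_preimage_image_self (i : ZMod N) (A : Set (CantorGroup N)) :
    prepend i ⁻¹' (prepend i '' A) = A := by
  rw [prepend_image]
  ext ω
  exact and_iff_right rfl

theorem prepend_preimage_image_of_ne {i j : ZMod N} (h : j ≠ i) (A : Set (CantorGroup N)) :
    prepend j ⁻¹' (prepend i '' A) = ∅ := by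
  rw [prepend_image]
  exact Set.eq_empty_of_forall_notMem fun ω hω => h hω.1

theorem cylinder_succ {n : ℕ} (I : Fin (n + 1) → ZMod N) :
    cylinder I = prepend (I 0) '' cylinder (Fin.tail I) := by
  rw [prepend_image]
  ext ω
  exact Fin.forall_fin_succ

end CantorGroup

section BranchSum

variable {N : ℕ} [NeZero N]

/-- The measure on the Cantor group that is `μ i`, transported by the inverse branch `σ_i`, on the
sequences with first letter `i`. -/
noncomputable def branchSum (μ : ZMod N → Measure (CantorGroup N)) : Measure (CantorGroup N) :=
  ∑ i, (μ i).map (prepend i)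

variable (μ : ZMod N → Measure (CantorGroup N)) [∀ i, IsFiniteMeasure (μ i)]

instance : IsFiniteMeasure (branchSum μ) := by
  unfold branchSum
  infer_instance

theorem branchSum_real_apply {A : Set (CantorGroup N)} (hA : MeasurableSet A) :
    (branchSum μ).real A = ∑ i, (μ i).real (prepend i ⁻¹' A) := by
  rw [Measure.real, branchSum, Measure.finsetSum_apply, ENNReal.toReal_sum fun _ _ => by finiteness]
  exact Finset.sum_congr rfl fun i _ => map_measureReal_apply (measurable_prepend i) hA

theorem branchSum_real_prepend_image (i : ZMod N) {A : Set (CantorGroup N)}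
    (hA : MeasurableSet A) : (branchSum μ).real (prepend i '' A) = (μ i).real A := by
  rw [branchSum_real_apply μ (measurableSet_prepend_image i hA), Finset.sum_eq_single i,
    prepend_preimage_image_self]
  · intro j _ hj
    rw [prepend_preimage_image_of_ne hj, measureReal_empty]
  · simp

theorem integral_branchSum {f : CantorGroup N → ℂ}
    (hf : ProjectionValuedMeasure.IsBoundedMeasurable f) :
    ∫ ω, f ω ∂(branchSum μ) = ∑ i, ∫ ω, f (prepend i ω) ∂(μ i) := by
  rw [branchSum, integral_finsetSum_measure fun i _ => hf.integrable _]
  exact Finset.sum_congr rfl fun i _ =>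
    integral_map (measurable_prepend i).aemeasurable hf.1.aestronglyMeasurable

end BranchSum

section Words

variable {N : ℕ} {H : Type*} [NormedAddCommGroup H] [InnerProductSpace ℂ H]

theorem wordOp_zero (S : ZMod N → H →L[ℂ] H) (I : Fin 0 → ZMod N) : wordOp S I = 1 := by
  simp [wordOp]

theorem wordOp_succ (S : ZMod N → H →L[ℂ] H) {n : ℕ} (I : Fin (n + 1) → ZMod N) :
    wordOp S I = S (I 0) * wordOp S (Fin.tail I) := by
  simp [wordOp, List.ofFn_succ, Fin.tail]

variable [CompleteSpace H]

theorem star_wordOp_succ_apply (S : ZMod N → H →L[ℂ] H) {n : ℕ} (I : Fin (n + 1) → ZMod N)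
    (ψ : H) : star (wordOp S I) ψ = star (wordOp S (Fin.tail I)) (star (S (I 0)) ψ) := by
  rw [wordOp_succ, star_mul]
  rfl

variable [NeZero N] {S : ZMod N → H →L[ℂ] H}

theorem IsRepresentation.star_mul_self (hS : IsRepresentation S) (i : ZMod N) :
    star (S i) * S i = 1 := by
  simp only [hS.star_mul, if_true]

theorem IsRepresentation.star_wordOp_mul_self (hS : IsRepresentation S) {n : ℕ}
    (I : Fin n → ZMod N) : star (wordOp S I) * wordOp S I = 1 := by
  induction n with
  | zero => simp only [wordOp_zero, star_one, mul_one]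
  | succ n ih =>
    rw [wordOp_succ, StarMul.star_mul, mul_assoc, ← mul_assoc (star (S (I 0))), hS.star_mul_self,
      one_mul, ih]

theorem IsRepresentation.sum_norm_sq (hS : IsRepresentation S) (ψ : H) :
    ∑ i, ‖star (S i) ψ‖ ^ 2 = ‖ψ‖ ^ 2 := by
  have h : ((∑ i, ‖star (S i) ψ‖ ^ 2 : ℝ) : ℂ) = ((‖ψ‖ ^ 2 : ℝ) : ℂ) :=
    calc ((∑ i, ‖star (S i) ψ‖ ^ 2 : ℝ) : ℂ)
        = ∑ i, inner ℂ ψ ((S i * star (S i)) ψ) := by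
          simp only [inner_mul_star_self_apply, Complex.ofReal_sum]
      _ = inner ℂ ψ ψ := by rw [← inner_sum, ← sum_apply, hS.sum_mul_star, one_apply_eq_self]
      _ = ((‖ψ‖ ^ 2 : ℝ) : ℂ) := by
          rw [Complex.ofReal_pow]; exact inner_self_eq_norm_sq_to_K ψ
  exact_mod_cast h

theorem IsRepresentation.branchSum_real_cylinder (hS : IsRepresentation S)
    {ν : H → Measure (CantorGroup N)} [∀ ψ, IsFiniteMeasure (ν ψ)] {n : ℕ}
    (hν : ∀ m ≤ n, ∀ (I : Fin m → ZMod N) ψ, (ν ψ).real (cylinder I) = ‖star (wordOp S I) ψ‖ ^ 2)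
    {m : ℕ} (hm : m ≤ n + 1) (I : Fin m → ZMod N) (ψ : H) :
    (branchSum fun i => ν (star (S i) ψ)).real (cylinder I) = ‖star (wordOp S I) ψ‖ ^ 2 := by
  cases m with
  | zero =>
    have hmass (φ : H) : (ν φ).real Set.univ = ‖φ‖ ^ 2 := by
      simpa only [cylinder_zero, wordOp_zero, star_one, one_apply_eq_self]
        using hν 0 n.zero_le Fin.elim0 φ
    simp only [cylinder_zero, branchSum_real_apply _ MeasurableSet.univ, Set.preimage_univ, hmass,
      hS.sum_norm_sq, wordOp_zero, star_one, one_apply_eq_self]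
  | succ m =>
    rw [cylinder_succ, branchSum_real_prepend_image _ _ (measurableSet_cylinder _),
      hν m (Nat.le_of_succ_le_succ hm), star_wordOp_succ_apply]

end Words

section SpectralMeasure

variable {N : ℕ} {H : Type*} [NormedAddCommGroup H] [InnerProductSpace ℂ H] [CompleteSpace H]
  {S : ZMod N → H →L[ℂ] H} {P Q : ProjectionValuedMeasure (CantorGroup N) H}

/-- `P` takes the value `S_I S_I*` on the cylinder set of every finite word `I`. -/
def IsSpectralMeasure (P : ProjectionValuedMeasure (CantorGroup N) H)
    (S : ZMod N → H →L[ℂ] H) : Prop :=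
  ∀ (n : ℕ) (I : Fin n → ZMod N), P (cylinder I) = wordOp S I * star (wordOp S I)

theorem IsSpectralMeasure.scalarMeasure_real_cylinder (hP : IsSpectralMeasure P S) {n : ℕ}
    (I : Fin n → ZMod N) (ψ : H) :
    (P.scalarMeasure ψ).real (cylinder I) = ‖star (wordOp S I) ψ‖ ^ 2 := by
  have h := (P.isSpectralProjection (measurableSet_cylinder I)).inner_apply ψ
  rw [hP, inner_mul_star_self_apply] at h
  exact_mod_cast h.symm

variable [NeZero N]

/-- The `n`-th approximation of the scalar measure of `ψ`: the mass `‖S_I* ψ‖²` is placed at the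
point `I00…`, for all words `I` of length `n`. -/
noncomputable def approxMeasure (S : ZMod N → H →L[ℂ] H) : ℕ → H → Measure (CantorGroup N)
  | 0, ψ => ENNReal.ofReal (‖ψ‖ ^ 2) • Measure.dirac 0
  | n + 1, ψ => branchSum fun i => approxMeasure S n (star (S i) ψ)

instance isFiniteMeasure_approxMeasure (n : ℕ) (ψ : H) : IsFiniteMeasure (approxMeasure S n ψ) := by
  induction n generalizing ψ with
  | zero => exact Measure.smul_finite _ ENNReal.ofReal_ne_top
  | succ n ih =>
    rw [approxMeasure]
    infer_instance

theorem IsRepresentation.approxMeasure_real_cylinder (hS : IsRepresentation S) {m n : ℕ}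
    (hmn : m ≤ n) (I : Fin m → ZMod N) (ψ : H) :
    (approxMeasure S n ψ).real (cylinder I) = ‖star (wordOp S I) ψ‖ ^ 2 := by
  induction n generalizing m ψ with
  | zero =>
    obtain rfl := Nat.le_zero.mp hmn
    simp [approxMeasure, cylinder_zero, wordOp_zero, Measure.real]
  | succ n ih => exact hS.branchSum_real_cylinder (fun _ hm I ψ => ih hm I ψ) hmn I ψ

theorem IsRepresentation.exists_measure_real_cylinder (hS : IsRepresentation S) (ψ : H) :
    ∃ μ : Measure (CantorGroup N), IsFiniteMeasure μ ∧ ∀ (n : ℕ) (I : Fin n → ZMod N),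
      μ.real (cylinder I) = ‖star (wordOp S I) ψ‖ ^ 2 := by
  have hmass (n : ℕ) : (approxMeasure S n ψ).real Set.univ ≤ ‖ψ‖ ^ 2 := by
    rw [← cylinder_zero Fin.elim0, hS.approxMeasure_real_cylinder n.zero_le, wordOp_zero, star_one,
      one_apply_eq_self]
  obtain ⟨μ, hμ, hlim⟩ := exists_isFiniteMeasure_real_eq_of_tendsto (l := atTop)
    (fun n => approxMeasure S n ψ) hmass
  refine ⟨μ, hμ, fun n I => hlim _ (isClopen_cylinder I) _ (tendsto_const_nhds.congr' ?_)⟩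
  filter_upwards [eventually_ge_atTop n] with k hk
  exact (hS.approxMeasure_real_cylinder hk I ψ).symm

open ProjectionValuedMeasure (IsSpectralProjection)

theorem IsRepresentation.exists_isSpectralMeasure (hS : IsRepresentation S) :
    ∃ P : ProjectionValuedMeasure (CantorGroup N) H, IsSpectralMeasure P S := by
  choose μ hfin hμ using hS.exists_measure_real_cylinder
  have hcyl (n : ℕ) (I : Fin n → ZMod N) :
      IsSpectralProjection μ (cylinder I) (wordOp S I * star (wordOp S I)) :=
    .of_star_mul_self (hS.star_wordOp_mul_self I) fun ψ => hμ ψ n I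
  have huniv : IsSpectralProjection μ Set.univ 1 := by
    simpa only [cylinder_zero, wordOp_zero, star_one, mul_one] using hcyl 0 Fin.elim0
  obtain ⟨P, hP⟩ := IsSpectralProjection.exists_projectionValuedMeasure huniv fun A hA =>
    huniv.exists_of_generateFrom measurableSpace_eq_generateFrom_cylinder isPiSystem_cylinder
      (by rintro _ ⟨n, I, rfl⟩; exact ⟨_, hcyl n I⟩) hA
  exact ⟨P, fun n I => (hP _ (measurableSet_cylinder I)).unique (hcyl n I)⟩

namespace IsSpectralMeasure

theorem unique (hP : IsSpectralMeasure P S) (hQ : IsSpectralMeasure Q S) : P = Q := by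
  refine P.ext_of_scalarMeasure (funext fun ψ => ext_of_real_cylinder fun n I => ?_)
  have hI := measurableSet_cylinder I
  have hPQ := (P.isSpectralProjection hI).inner_apply ψ
  rw [hP, ← hQ, (Q.isSpectralProjection hI).inner_apply] at hPQ
  exact_mod_cast hPQ.symm

theorem scalarMeasure_eq_branchSum (hP : IsSpectralMeasure P S) (hS : IsRepresentation S) (ψ : H) :
    P.scalarMeasure ψ = branchSum fun i => P.scalarMeasure (star (S i) ψ) :=
  ext_of_real_cylinder fun n I => by
    rw [hP.scalarMeasure_real_cylinder, hS.branchSum_real_cylinder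
      (fun _ _ I φ => hP.scalarMeasure_real_cylinder I φ) n.le_succ]

end IsSpectralMeasure

end SpectralMeasure

open ProjectionValuedMeasure (IsBoundedMeasurable)

section Pairing

variable {N : ℕ}

theorem eventually_eq_zero (ξ : DualGroup N) : ∀ᶠ k in atTop, ξ k = 0 := by
  rw [← Nat.cofinite_eq_atTop]
  exact ξ.hasFiniteSupport

theorem pairing_eq_of_mem_cylinder {n : ℕ} {ξ : DualGroup N} (hξ : ∀ k, n ≤ k → ξ k = 0)
    {I : Fin n → ZMod N} {ω : CantorGroup N} (hω : ω ∈ cylinder I) :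
    pairing ω ξ = pairing (extendZero I) ξ := by
  refine Finset.prod_congr rfl fun k hk => ?_
  have hkn : k < n := not_le.1 fun h => Finsupp.mem_support_iff.1 hk (hξ k h)
  rw [extendZero, dif_pos hkn, hω ⟨k, hkn⟩]

variable [NeZero N]

theorem pairing_eq_prod (ω : CantorGroup N) (ξ : DualGroup N) :
    pairing ω ξ = ξ.prod fun k b => ZMod.stdAddChar (ω k * b) := by
  refine Finset.prod_congr rfl fun k _ => ?_
  have h := ZMod.stdAddChar_coe (N := N) ((ω k).val * (ξ k).val : ℤ)
  push_cast at h
  rw [← h, ZMod.natCast_zmod_val, ZMod.natCast_zmod_val]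

theorem pairing_zero_right (ω : CantorGroup N) : pairing ω (0 : DualGroup N) = 1 := by
  rw [pairing_eq_prod, Finsupp.prod_zero_index]

theorem pairing_add_right (ω : CantorGroup N) (ξ η : DualGroup N) :
    pairing ω (ξ + η) = pairing ω ξ * pairing ω η := by
  simp only [pairing_eq_prod]
  exact Finsupp.prod_add_index' (fun k => by rw [mul_zero, AddChar.map_zero_eq_one])
    fun k b c => by rw [mul_add, AddChar.map_add_eq_mul]

theorem pairing_neg_right (ω : CantorGroup N) (ξ : DualGroup N) :
    pairing ω (-ξ) = star (pairing ω ξ) := by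
  simp only [pairing_eq_prod]
  rw [Finsupp.prod_neg_index fun k => by rw [mul_zero, AddChar.map_zero_eq_one], Finsupp.prod,
    Finsupp.prod, star_prod]
  exact Finset.prod_congr rfl fun k _ => by
    rw [mul_neg]
    exact AddChar.map_neg_eq_conj _ _

theorem norm_pairing (ω : CantorGroup N) (ξ : DualGroup N) : ‖pairing ω ξ‖ = 1 := by
  rw [pairing_eq_prod, Finsupp.prod, norm_prod]
  exact Finset.prod_eq_one fun k _ => AddChar.norm_apply _ _

theorem isBoundedMeasurable_pairing (ξ : DualGroup N) :
    IsBoundedMeasurable fun ω : CantorGroup N => pairing ω ξ := by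
  refine ⟨?_, 1, fun ω => (norm_pairing ω ξ).le⟩
  simp only [pairing_eq_prod]
  exact Finset.measurable_prod _ fun k _ =>
    (Measurable.of_discrete (f := fun a : ZMod N => (ZMod.stdAddChar (a * ξ k) : ℂ))).comp
      (measurable_pi_apply k)

theorem pairing_eq_sum_indicator {n : ℕ} {ξ : DualGroup N} (hξ : ∀ k, n ≤ k → ξ k = 0)
    (ω : CantorGroup N) : pairing ω ξ =
      ∑ I : Fin n → ZMod N, (cylinder I).indicator (fun _ => pairing (extendZero I) ξ) ω := by
  rw [Finset.sum_eq_single fun k : Fin n => ω k]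
  · rw [Set.indicator_of_mem (mem_cylinder_restrict ω n),
      pairing_eq_of_mem_cylinder hξ (mem_cylinder_restrict ω n)]
  · intro I _ hI
    exact Set.indicator_of_notMem (fun h => hI (funext fun k => (h k).symm)) _
  · simp

end Pairing

section UnitaryRep

variable {N : ℕ} {H : Type*} [NormedAddCommGroup H] [InnerProductSpace ℂ H]
  [CompleteSpace H] (P : ProjectionValuedMeasure (CantorGroup N) H)

theorem cylinder_mul_cylinder {n : ℕ} (I J : Fin n → ZMod N) :
    P (cylinder I) * P (cylinder J) = if I = J then P (cylinder I) else 0 := by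
  rw [← P.inter' _ _ (measurableSet_cylinder I) (measurableSet_cylinder J)]
  split_ifs with h
  · rw [h, Set.inter_self]
  · rw [(disjoint_cylinder h).inter_eq, P.empty]

variable [NeZero N]

theorem integral_pairing_eq_sum {n : ℕ} {ξ : DualGroup N} (hξ : ∀ k, n ≤ k → ξ k = 0) :
    P.integral (fun ω => pairing ω ξ) =
      ∑ I : Fin n → ZMod N, pairing (extendZero I) ξ • P (cylinder I) := by
  refine ProjectionValuedMeasure.HasIntegral.integral_eq ?_ (isBoundedMeasurable_pairing ξ)
  rw [funext (pairing_eq_sum_indicator hξ)]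
  exact .sum (fun I _ => P.hasIntegral_indicator_const (measurableSet_cylinder I) _)
    fun I _ => .indicator_const (measurableSet_cylinder I) _

theorem integral_pairing_zero : P.integral (fun ω => pairing ω 0) = 1 := by
  rw [integral_pairing_eq_sum P (n := 0) fun _ _ => rfl]
  simp only [pairing_zero_right, cylinder_zero, P.univ', one_smul, Finset.univ_unique,
    Finset.sum_const, Finset.card_singleton]

theorem integral_pairing_add (ξ η : DualGroup N) :
    P.integral (fun ω => pairing ω (ξ + η)) =
      P.integral (fun ω => pairing ω ξ) * P.integral fun ω => pairing ω η := by
  obtain ⟨n, hn⟩ := eventually_atTop.1 ((eventually_eq_zero ξ).and (eventually_eq_zero η))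
  rw [integral_pairing_eq_sum P fun k hk => (hn k hk).1,
    integral_pairing_eq_sum P fun k hk => (hn k hk).2,
    integral_pairing_eq_sum P (n := n) fun k hk => by
      rw [Finsupp.add_apply, (hn k hk).1, (hn k hk).2, add_zero], Finset.sum_mul_sum]
  simp only [smul_mul_smul_comm, cylinder_mul_cylinder, smul_ite, smul_zero,
    Finset.sum_ite_eq, Finset.mem_univ, if_true, pairing_add_right]

theorem star_integral_pairing (ξ : DualGroup N) :
    star (P.integral fun ω => pairing ω ξ) = P.integral fun ω => pairing ω (-ξ) := by
  refine (ProjectionValuedMeasure.HasIntegral.integral_eq ?_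
    (isBoundedMeasurable_pairing (-ξ))).symm
  simp only [pairing_neg_right]
  exact (P.hasIntegral_integral (isBoundedMeasurable_pairing ξ)).star

/-- The unitary representation `ξ ↦ ∫ ⟨ω, ξ⟩ P(dω)` of the dual group, written multiplicatively. -/
noncomputable def unitaryRep : Multiplicative (DualGroup N) →* unitary (H →L[ℂ] H) where
  toFun ξ := ⟨P.integral fun ω => pairing ω ξ.toAdd, by
    rw [Unitary.mem_iff, star_integral_pairing, ← integral_pairing_add, ← integral_pairing_add,
      neg_add_cancel, add_neg_cancel, integral_pairing_zero]
    exact ⟨rfl, rfl⟩⟩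
  map_one' := Subtype.ext (integral_pairing_zero P)
  map_mul' ξ η := Subtype.ext (integral_pairing_add P ξ.toAdd η.toAdd)

theorem coe_unitaryRep_ofAdd (ξ : DualGroup N) :
    (unitaryRep P (Multiplicative.ofAdd ξ) : H →L[ℂ] H) = P.integral fun ω => pairing ω ξ := rfl

end UnitaryRep

section Endomorphism

variable {N : ℕ} [NeZero N] {H : Type*} [NormedAddCommGroup H] [InnerProductSpace ℂ H]
  [CompleteSpace H] {S : ZMod N → H →L[ℂ] H} {P : ProjectionValuedMeasure (CantorGroup N) H}

theorem IsRepresentation.mul_mul_star_mul (hS : IsRepresentation S) (T T' : H →L[ℂ] H)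
    (i j : ZMod N) : S i * T * star (S i) * (S j * T' * star (S j)) =
      if i = j then S i * (T * T') * star (S i) else 0 := by
  calc S i * T * star (S i) * (S j * T' * star (S j))
      = S i * T * (star (S i) * S j) * T' * star (S j) := by simp only [mul_assoc]
    _ = _ := by
      rw [hS.star_mul]
      split_ifs with hij
      · simp only [← hij, mul_assoc, one_mul]
      · simp only [mul_zero, zero_mul]

/-- The endomorphism `T ↦ ∑ᵢ Sᵢ T Sᵢ*` of `B(H)`. -/
noncomputable def canonicalEndomorphism (hS : IsRepresentation S) :
    (H →L[ℂ] H) →⋆ₐ[ℂ] (H →L[ℂ] H) where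
  toFun T := ∑ i, S i * T * star (S i)
  map_one' := by simp only [mul_one, hS.sum_mul_star]
  map_mul' T T' := by
    simp only [Finset.sum_mul_sum, hS.mul_mul_star_mul, Finset.sum_ite_eq, Finset.mem_univ, if_true]
  map_zero' := by simp only [mul_zero, zero_mul, Finset.sum_const_zero]
  map_add' T T' := by simp only [mul_add, add_mul, Finset.sum_add_distrib]
  commutes' c := by
    simp only [Algebra.algebraMap_eq_smul_one, mul_smul_comm, smul_mul_assoc, mul_one,
      ← Finset.smul_sum, hS.sum_mul_star]
  map_star' T := by simp only [star_sum, StarMul.star_mul, star_star, mul_assoc]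

theorem canonicalEndomorphism_apply (hS : IsRepresentation S) (T : H →L[ℂ] H) :
    canonicalEndomorphism hS T = ∑ i, S i * T * star (S i) := rfl

namespace IsSpectralMeasure

theorem hasIntegral_sum_mul_mul_star (hP : IsSpectralMeasure P S) (hS : IsRepresentation S)
    {f : CantorGroup N → ℂ} (hf : IsBoundedMeasurable f) {T : ZMod N → H →L[ℂ] H}
    (hT : ∀ i, P.HasIntegral (fun ω => f (prepend i ω)) (T i)) :
    P.HasIntegral f (∑ i, S i * T i * star (S i)) := fun ψ => by
  rw [sum_apply, inner_sum, hP.scalarMeasure_eq_branchSum hS, integral_branchSum _ hf]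
  exact Finset.sum_congr rfl fun i _ => by rw [inner_mul_star_apply, hT]

theorem sum_mul_prepend_preimage_mul_star (hP : IsSpectralMeasure P S) (hS : IsRepresentation S)
    {A : Set (CantorGroup N)} (hA : MeasurableSet A) :
    ∑ i, S i * P (prepend i ⁻¹' A) * star (S i) = P A := by
  have hP_eq {B : Set (CantorGroup N)} (hB : MeasurableSet B) :
      P.HasIntegral (B.indicator fun _ => 1) (P B) := by
    simpa only [one_smul] using P.hasIntegral_indicator_const hB 1
  exact (hP.hasIntegral_sum_mul_mul_star hS (.indicator_const hA 1)
    fun i => hP_eq (measurable_prepend i hA)).unique (hP_eq hA)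

theorem mul_mul_star_eq_prepend_image (hP : IsSpectralMeasure P S) (hS : IsRepresentation S)
    (i : ZMod N) {A : Set (CantorGroup N)} (hA : MeasurableSet A) :
    S i * P A * star (S i) = P (prepend i '' A) := by
  rw [← hP.sum_mul_prepend_preimage_mul_star hS (measurableSet_prepend_image i hA),
    Finset.sum_eq_single i, prepend_preimage_image_self]
  · intro j _ hj
    rw [prepend_preimage_image_of_ne hj, P.empty, mul_zero, zero_mul]
  · simp

theorem canonicalEndomorphism_apply_shift (hP : IsSpectralMeasure P S) (hS : IsRepresentation S)
    {A : Set (CantorGroup N)} (hA : MeasurableSet A) :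
    canonicalEndomorphism hS (P A) = P (shift ⁻¹' A) :=
  hP.sum_mul_prepend_preimage_mul_star hS (measurable_shift hA)

theorem canonicalEndomorphism_integral (hP : IsSpectralMeasure P S) (hS : IsRepresentation S)
    {f : CantorGroup N → ℂ} (hf : IsBoundedMeasurable f) :
    canonicalEndomorphism hS (P.integral f) = P.integral fun ω => f (shift ω) := by
  have hfσ : IsBoundedMeasurable fun ω => f (shift ω) :=
    ⟨hf.1.comp measurable_shift, hf.2.imp fun _ hC _ => hC _⟩
  exact ((hP.hasIntegral_sum_mul_mul_star hS hfσ fun _ => P.hasIntegral_integral hf).integral_eq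
    hfσ).symm

theorem canonicalEndomorphism_integral_pairing (hP : IsSpectralMeasure P S)
    (hS : IsRepresentation S) (ξ : DualGroup N) :
    canonicalEndomorphism hS (P.integral fun ω => pairing ω ξ) =
      P.integral fun ω => pairing ω (dualShift ξ) := by
  simp only [hP.canonicalEndomorphism_integral hS (isBoundedMeasurable_pairing ξ),
    pairing_dualShift]

end IsSpectralMeasure

end Endomorphism

end Cuntz

theorem theorem2 (N : ℕ) [NeZero N] (hN : 2 ≤ N) {H : Type*} [NormedAddCommGroup H]
    [InnerProductSpace ℂ H] [CompleteSpace H] (S : ZMod N → H →L[ℂ] H)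
    (hS : Cuntz.IsRepresentation S) :
    -- there is exactly one projection-valued measure with the prescribed values on cylinders
    ∃ P : ProjectionValuedMeasure (Cuntz.CantorGroup N) H,
      (∀ (n : ℕ) (I : Fin n → ZMod N),
        P (Cuntz.cylinder I) = Cuntz.wordOp S I * star (Cuntz.wordOp S I)) ∧
      (∀ Q : ProjectionValuedMeasure (Cuntz.CantorGroup N) H,
        (∀ (n : ℕ) (I : Fin n → ZMod N),
          Q (Cuntz.cylinder I) = Cuntz.wordOp S I * star (Cuntz.wordOp S I)) → Q = P) ∧
      -- the unitary representation `U` of the (discrete) dual group and the endomorphism `α`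
      ∃ (U : Multiplicative (Cuntz.DualGroup N) →* unitary (H →L[ℂ] H))
        (α : (H →L[ℂ] H) →⋆ₐ[ℂ] (H →L[ℂ] H)),
        (∀ (ξ : Cuntz.DualGroup N) (n : ℕ), (∀ k, n ≤ k → ξ k = 0) →
          (U (Multiplicative.ofAdd ξ) : H →L[ℂ] H) =
            ∑ I : Fin n → ZMod N, Cuntz.pairing (Cuntz.extendZero I) ξ •
              (Cuntz.wordOp S I * star (Cuntz.wordOp S I))) ∧
        (∀ T : H →L[ℂ] H, α T = ∑ i, S i * T * star (S i)) ∧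
        -- `P` is the spectral measure of `U`
        (∀ ξ : Cuntz.DualGroup N,
          (U (Multiplicative.ofAdd ξ) : H →L[ℂ] H) = P.integral fun ω => Cuntz.pairing ω ξ) ∧
        (∀ (i : ZMod N) (A : Set (Cuntz.CantorGroup N)), MeasurableSet A →
          S i * P A * star (S i) = P (Cuntz.prepend i '' A)) ∧
        (∀ A : Set (Cuntz.CantorGroup N), MeasurableSet A →
          ∑ i, S i * P (Cuntz.prepend i ⁻¹' A) * star (S i) = P A) ∧
        (∀ A : Set (Cuntz.CantorGroup N), MeasurableSet A → α (P A) = P (Cuntz.shift ⁻¹' A)) ∧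
        (∀ f : Cuntz.CantorGroup N → ℂ, ProjectionValuedMeasure.IsBoundedMeasurable f →
          α (P.integral f) = P.integral fun ω => f (Cuntz.shift ω)) ∧
        (∀ ξ : Cuntz.DualGroup N,
          α (U (Multiplicative.ofAdd ξ) : H →L[ℂ] H) =
            (U (Multiplicative.ofAdd (Cuntz.dualShift ξ)) : H →L[ℂ] H)) := by
  obtain ⟨P, hP⟩ := hS.exists_isSpectralMeasure
  refine ⟨P, hP, fun Q hQ => Cuntz.IsSpectralMeasure.unique hQ hP, Cuntz.unitaryRep P,
    Cuntz.canonicalEndomorphism hS, ?_, Cuntz.canonicalEndomorphism_apply hS,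
    Cuntz.coe_unitaryRep_ofAdd P,
    fun i A hA => hP.mul_mul_star_eq_prepend_image hS i hA,
    fun A hA => hP.sum_mul_prepend_preimage_mul_star hS hA,
    fun A hA => hP.canonicalEndomorphism_apply_shift hS hA,
    fun f hf => hP.canonicalEndomorphism_integral hS hf,
    hP.canonicalEndomorphism_integral_pairing hS⟩
  intro ξ n hξ
  simp only [← hP n]
  exact Cuntz.integral_pairing_eq_sum P hξ
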